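/- Let $x>0$. Write $\mathcal F^{-1}[f](t)=\frac1{2\pi}\int_{\mathbb R}f(\xi)e^{-it\xi}\,d\xi$ for $f\in L^1(\mathbb R)$, and use the same symbol for its extension to $L^2(\mathbb R)$. Let $\sigma_{(1)},\sigma_{(2)}:\mathbb R\to\mathbb C$ satisfy $\sigma_{(1)}-1\in L^1(\mathbb R)$ and $\sigma_{(2)}-1\in L^2(\mathbb R)$, and for $\ell=1,2$ let $K_{(\ell)}$ also denote the truncated Wiener–Hopf integral operator $$(K_{(\ell)}g)(t)=\int_0^xK_{(\ell)}(t-t')g(t')\,dt',\qquad K_{(\ell)}(t)=\mathcal F^{-1}[\sigma_{(\ell)}-1](t),$$ on $L^2([0,x])$. Let $V_{(1)},V_{(2)}$ be the integral operators on $L^2(\mathbb R)$ with kernels $$V_{(1)}(\xi,\eta)=\sqrt{\sigma_{(1)}(\xi)-1}\,\sqrt{\sigma_{(1)}(\eta)-1}\;\frac{e^{ix(\xi-\eta)/2}-e^{-ix(\xi-\eta)/2}}{2\pi i(\xi-\eta)},$$ $$V_{(2)}(\xi,\eta)=\bigl(\sigma_{(2)}(\xi)-1\bigr)\frac{e^{ix(\xi-\eta)/2}-e^{-ix(\xi-\eta)/2}}{2\pi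 i(\xi-\eta)},$$ where $\sqrt{\sigma_{(1)}-1}$ is any measurable square root of $\sigma_{(1)}-1$. For an operator $T$ on a Hilbert space, $\det(I+T)$ denotes the Fredholm determinant if $T$ is trace class, and $\det_2(I+T)=\det\bigl((I+T)e^{-T}\bigr)$ the 2-regularized determinant if $T$ is Hilbert–Schmidt. Then $K_{(2)}$ and $V_{(2)}$ are bounded and Hilbert–Schmidt, $(I+K_{(2)})e^{-K_{(2)}}-I$ and $(I+V_{(2)})e^{-V_{(2)}}-I$ are trace class, and $$\det\nolimits_2(I+K_{(2)})=\det\nolimits_2(I+V_{(2)}).$$ The same holds if $K_{(2)}$ is regarded as an operator on $L^2(\mathbb R)$, given by the same formula for $t\in\mathbb R$. Moreover $K_{(1)}$ and $V_{(1)}$ are bounded and trace class, and $$\det(I+K_{(1)})=\det(I+V_{(1)}).$$ -/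

import Mathlib

open MeasureTheory

noncomputable section

namespace WienerHopf

section Operators

variable {H : Type*} [NormedAddCommGroup H] [InnerProductSpace ℂ H] [CompleteSpace H]

/-- `T` is Hilbert-Schmidt: `∑ ‖T eᵢ‖² < ∞` for every Hilbert basis `(eᵢ)` of `H`. -/
def IsHilbertSchmidt (T : H →L[ℂ] H) : Prop :=
  ∀ (s : Set H) (b : HilbertBasis s ℂ H), Summable fun i => ‖T (b i)‖ ^ 2

/-- `T` is trace class (equivalently, on a Hilbert space, nuclear): it is a sum of rank-one
operators `g ↦ ⟨uₙ, g⟩ vₙ` with `∑ ‖uₙ‖ ‖vₙ‖ < ∞`. -/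
def IsTraceClass (T : H →L[ℂ] H) : Prop :=
  ∃ u v : ℕ → H, (Summable fun n => ‖u n‖ * ‖v n‖) ∧
    ∀ g : H, HasSum (fun n => (inner ℂ (u n) g : ℂ) • v n) (T g)

/-- `Tr Λⁿ(T)`, computed in a Hilbert basis `(eᵢ)`: the sum of the minors `det ⟨e_{i_k}, T e_{i_l}⟩`
over all `n`-element sets of indices, written as `1 / n!` times the sum over all `n`-tuples. -/
def traceExteriorPower {ι : Type*} (b : HilbertBasis ι ℂ H) (T : H →L[ℂ] H) (n : ℕ) : ℂ :=
  ((n.factorial : ℕ) : ℂ)⁻¹ *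
    ∑' i : Fin n → ι, Matrix.det (Matrix.of fun k l : Fin n => (inner ℂ (b (i k)) (T (b (i l))) : ℂ))

/-- The Fredholm determinant `det A = ∑ₙ Tr Λⁿ(A - I)` of an operator `A` such that `A - I` is
trace class. For such `A` the series converge absolutely and do not depend on the basis. -/
def fredholmDet (A : H →L[ℂ] H) : ℂ :=
  ∑' n : ℕ, traceExteriorPower (exists_hilbertBasis ℂ H).choose_spec.choose (A - 1) n

/-- The 2-regularized determinant: `det₂ (I + T) = det ((I + T) e^{-T})`. -/
def fredholmDet₂ (A : H →L[ℂ] H) : ℂ :=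
  fredholmDet (A * NormedSpace.exp (-(A - 1)))

end Operators

/-- `T` is the integral operator on `L²(μ)` with kernel `k`:
`(T g)(t) = ∫ k(t, t') g(t') dμ(t')` for almost every `t`, the integral being absolutely
convergent. There is at most one such `T`. -/
def IsIntegralOperator (μ : Measure ℝ) (k : ℝ → ℝ → ℂ) (T : Lp ℂ 2 μ →L[ℂ] Lp ℂ 2 μ) : Prop :=
  ∀ g : Lp ℂ 2 μ, ∀ᵐ t ∂μ,
    Integrable (fun t' => k t t' * g t') μ ∧ T g t = ∫ t', k t t' * g t' ∂μ

/-- The inverse Fourier transform `(1 / 2π) ∫ f(ξ) e^{-itξ} dξ` of an integrable function. -/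
def fourierInvL1 (f : ℝ → ℂ) (t : ℝ) : ℂ :=
  1 / (2 * Real.pi) * ∫ ξ : ℝ, f ξ * Complex.exp (-Complex.I * t * ξ)

open scoped FourierTransform in
/-- The same inverse Fourier transform `(1 / 2π) ∫ f(ξ) e^{-itξ} dξ`, extended to `L²(ℝ)`.
Mathlib's `𝓕` is the `L²` extension of `f ↦ ∫ f(ξ) e^{-2πiξw} dξ`, taken here at `w = t / 2π`. -/
def fourierInvL2 (f : Lp ℂ 2 (volume : Measure ℝ)) (t : ℝ) : ℂ :=
  1 / (2 * Real.pi) * (𝓕 f : Lp ℂ 2 (volume : Measure ℝ)) (t / (2 * Real.pi))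

/-- The sine kernel `(e^{ix(ξ-η)/2} - e^{-ix(ξ-η)/2}) / (2πi(ξ-η))`, with its limiting value
`x / 2π` on the diagonal. -/
def sineKernel (x ξ η : ℝ) : ℂ :=
  if ξ = η then x / (2 * Real.pi) else
    (Complex.exp (Complex.I * x * (ξ - η) / 2) - Complex.exp (-Complex.I * x * (ξ - η) / 2)) /
      (2 * Real.pi * Complex.I * (ξ - η))

/-- Lebesgue measure on the segment `[0, x]`. -/
abbrev segment (x : ℝ) : Measure ℝ := volume.restrict (Set.Icc 0 x)

/-- The kernel `V₍₁₎`, for a choice `r` of a square root of `σ - 1`. -/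
def kernelV1 (x : ℝ) (r : ℝ → ℂ) (ξ η : ℝ) : ℂ := r ξ * r η * sineKernel x ξ η

/-- The kernel `V₍₂₎`. -/
def kernelV2 (x : ℝ) (σ : ℝ → ℂ) (ξ η : ℝ) : ℂ := (σ ξ - 1) * sineKernel x ξ η

end WienerHopf

end

/-!
The Wiener-Hopf operator `K` and the operator `V` with the sine kernel are `A B` and `B A` for the
same two operators: up to normalization and a factor of `σ - 1`, `B` takes a function on `[0, x]` to
its Fourier transform and `A` inverts the Fourier transform and restricts to `[0, x]`. The sine
kernel is the integral over the segment of the plane waves `e^{i(ξ - η)(t - x/2)}` (`integral_wave`).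
The phases are centred at `x/2`, which cancels in `K` and makes the sine kernel come out symmetric.

The determinants agree because a Fredholm determinant is insensitive to the order of the factors.
If `T = ∑ ⟨uₘ, ·⟩ vₘ` is nuclear, then `Tr Λⁿ(T)` is a sum of determinants `det ⟨u_{m_k}, v_{m_l}⟩`,
whatever the basis used to define it (`traceExteriorPower_eq_tsum_det`).

* If `σ - 1` is integrable with square root `r`, each of `A` and `B` carries one factor `r` and is
  Hilbert-Schmidt. Then `A B = ∑ ⟨B†eᵢ, ·⟩ A eᵢ`, and `⟨B†eᵢ, A eⱼ⟩ = ⟨eᵢ, B A eⱼ⟩` are the matrix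
  entries of `B A` (`fredholmDet_one_add_comp_comm`).
* If `σ - 1` is square integrable, `B` carries the whole factor and is Hilbert-Schmidt, and `A` is
  only bounded. Since `(1 + z) e^{-z} - 1` vanishes to second order, `(I + AB) e^{-AB} - I = A C`
  and `(I + BA) e^{-BA} - I = C A` with `C = B Q A B` nuclear, so that both determinants are
  series in `det ⟨uₖ, A vₗ⟩` where `C = ∑ ⟨uₘ, ·⟩ vₘ` (`fredholmDet₂_one_add_comp_comm`). On `L²(ℝ)` the
  restriction `R` to the segment moves from `A` to `B`: `K = (R A) B`, `K' = A (B R)` and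
  `V = B (R A)`.

The kernels of the products are found by Fubini's theorem in the integrable case. In the square
integrable case they come from the multiplication formula `∫ 𝓕f · g = ∫ f · 𝓕g` together with the
fact that on `L¹ ∩ L²` the Fourier transform is given by the integral (`fourier_toLp_ae_eq`).
-/

namespace WienerHopf

/-! ### Traces of exterior powers of nuclear operators -/

/-- A product of finitely many absolutely convergent series is an absolutely convergent series over
tuples. -/
theorem hasSum_pi_prod {ι : Type*} {n : ℕ} (f : Fin n → ι → ℂ)
    (hf : ∀ k, Summable fun i => ‖f k i‖) :
    Summable (fun m : Fin n → ι => ‖∏ k, f k (m k)‖) ∧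
      HasSum (fun m : Fin n → ι => ∏ k, f k (m k)) (∏ k, ∑' i, f k i) := by
  induction n with
  | zero =>
    refine ⟨(hasSum_fintype _).summable, ?_⟩
    simp
  | succ n ih =>
    obtain ⟨h1, h2⟩ := ih (fun k => f k.succ) fun k => hf k.succ
    have e : ∀ p : ι × (Fin n → ι),
        ∏ k, f k (Fin.consEquiv (fun _ => ι) p k) = f 0 p.1 * ∏ k, f (Fin.succ k) (p.2 k) := by
      intro p
      simp [Fin.prod_univ_succ, Fin.consEquiv]
    constructor
    · rw [← (Fin.consEquiv fun _ => ι).summable_iff]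
      refine ((hf 0).mul_norm h1).congr fun p => ?_
      rw [← e p]
      rfl
    · rw [← (Fin.consEquiv fun _ => ι).hasSum_iff, Fin.prod_univ_succ]
      set g : (Fin n → ι) → ℂ := fun m => ∏ k, f (Fin.succ k) (m k) with hg
      have h5 : Summable fun p : ι × (Fin n → ι) => f 0 p.1 * g p.2 :=
        summable_mul_of_summable_norm (hf 0) h1
      have h4 := HasSum.mul (hf 0).of_norm.hasSum h2 h5
      have h6 : ((fun m : Fin (n + 1) → ι => ∏ k, f k (m k)) ∘ (Fin.consEquiv fun _ => ι)) =
          fun p => f 0 p.1 * g p.2 := funext e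
      rw [h6]
      exact h4

section Hilbert

variable {H : Type*} [NormedAddCommGroup H] [InnerProductSpace ℂ H]

theorem sum_norm_inner_mul_le {ι : Type*} (b : HilbertBasis ι ℂ H) (u v : H) (s : Finset ι) :
    ∑ i ∈ s, ‖(inner ℂ u (b i) * inner ℂ (b i) v : ℂ)‖ ≤ ‖u‖ * ‖v‖ := by
  calc ∑ i ∈ s, ‖(inner ℂ u (b i) * inner ℂ (b i) v : ℂ)‖
      = ∑ i ∈ s, ‖(inner ℂ (b i) u : ℂ)‖ * ‖(inner ℂ (b i) v : ℂ)‖ := by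
        simp only [norm_mul, norm_inner_symm u]
    _ ≤ √(∑ i ∈ s, ‖(inner ℂ (b i) u : ℂ)‖ ^ 2) * √(∑ i ∈ s, ‖(inner ℂ (b i) v : ℂ)‖ ^ 2) :=
        Real.sum_mul_le_sqrt_mul_sqrt _ _ _
    _ ≤ √(‖u‖ ^ 2) * √(‖v‖ ^ 2) := by
        gcongr <;> exact b.orthonormal.sum_inner_products_le _
    _ = ‖u‖ * ‖v‖ := by simp

theorem summable_norm_inner_mul {ι : Type*} (b : HilbertBasis ι ℂ H) (u v : H) :
    Summable fun i => ‖(inner ℂ u (b i) * inner ℂ (b i) v : ℂ)‖ :=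
  summable_of_sum_le (fun _ => norm_nonneg _) (sum_norm_inner_mul_le b u v)

theorem tsum_norm_inner_mul_le {ι : Type*} (b : HilbertBasis ι ℂ H) (u v : H) :
    ∑' i, ‖(inner ℂ u (b i) * inner ℂ (b i) v : ℂ)‖ ≤ ‖u‖ * ‖v‖ :=
  (summable_norm_inner_mul b u v).tsum_le_of_sum_le (sum_norm_inner_mul_le b u v)

/-- For a nuclear operator `T = ∑ ⟨uₘ, ·⟩ vₘ`, the trace of `Λⁿ(T)` computed in any Hilbert basis is
a sum of Gram-type determinants `det ⟨u_{m_k}, v_{m_l}⟩`; no trace of the basis is left. Both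
sides are rearrangements of one absolutely convergent double series. -/
theorem traceExteriorPower_eq_tsum_det {ι I : Type*} (b : HilbertBasis ι ℂ H) (T : H →L[ℂ] H)
    (u v : I → H) (hs : Summable fun m => ‖u m‖ * ‖v m‖)
    (hT : ∀ g, HasSum (fun m => (inner ℂ (u m) g : ℂ) • v m) (T g)) (n : ℕ) :
    traceExteriorPower b T n = ((n.factorial : ℕ) : ℂ)⁻¹ *
      ∑' m : Fin n → I, Matrix.det
        (Matrix.of fun k l : Fin n => (inner ℂ (u (m k)) (v (m l)) : ℂ)) := by
  unfold traceExteriorPower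
  congr 1
  -- the term of `σ` in the determinant, with `T` expanded into rank-one operators
  let F : Equiv.Perm (Fin n) → (Fin n → I) → (Fin n → ι) → ℂ := fun σ m i =>
    ∏ k, (inner ℂ (u (m k)) (b (i k)) * inner ℂ (b (i (σ k))) (v (m k)) : ℂ)
  -- moving `σ` from the basis index to the index of `v`
  have hF : ∀ σ m i, F σ m i =
      ∏ k, (inner ℂ (u (m k)) (b (i k)) * inner ℂ (b (i k)) (v (m (σ⁻¹ k))) : ℂ) := by
    intro σ m i
    simp only [F, Finset.prod_mul_distrib]
    congr 1
    rw [← Equiv.prod_comp σ fun k => (inner ℂ (b (i k)) (v (m (σ⁻¹ k))) : ℂ)]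
    simp
  have h1 : ∀ σ i, HasSum (fun m => F σ m i) (∏ k, (inner ℂ (b (i (σ k))) (T (b (i k))) : ℂ)) := by
    intro σ i
    have hk : ∀ k, Summable fun m : I =>
        ‖(inner ℂ (u m) (b (i k)) * inner ℂ (b (i (σ k))) (v m) : ℂ)‖ := by
      intro k
      refine Summable.of_nonneg_of_le (fun _ => norm_nonneg _) (fun m => ?_) hs
      rw [norm_mul]
      have h := b.orthonormal.1
      have h1 := norm_inner_le_norm (𝕜 := ℂ) (u m) (b (i k))
      have h2 := norm_inner_le_norm (𝕜 := ℂ) (b (i (σ k))) (v m)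
      rw [h, mul_one] at h1
      rw [h, one_mul] at h2
      gcongr
    convert! (hasSum_pi_prod _ hk).2 using 2 with k
    have := (hT (b (i k))).mapL (innerSL ℂ (b (i (σ k))))
    simp only [innerSL_apply_apply, inner_smul_right] at this
    rw [this.tsum_eq]
  have h2 : ∀ σ m, HasSum (fun i => F σ m i) (∏ k, (inner ℂ (u (m k)) (v (m (σ⁻¹ k))) : ℂ)) := by
    intro σ m
    simp only [hF]
    convert! (hasSum_pi_prod _ fun k => summable_norm_inner_mul b (u (m k)) (v (m (σ⁻¹ k)))).2
      using 2 with k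
    exact (b.tsum_inner_mul_inner _ _).symm
  -- by Bessel, the sum over `i` is at most `∏ ‖u_{m_k}‖ ‖v_{m_k}‖`, which is summable over `m`
  have h3 : ∀ σ, Summable fun p : (Fin n → I) × (Fin n → ι) => F σ p.1 p.2 := by
    intro σ
    have hb : ∀ m, Summable fun i => ‖F σ m i‖ := fun m => by
      simp only [hF]
      exact (hasSum_pi_prod _ fun k => summable_norm_inner_mul b (u (m k)) (v (m (σ⁻¹ k)))).1
    refine Summable.of_norm ((summable_prod_of_nonneg fun _ => norm_nonneg _).2 ⟨hb, ?_⟩)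
    have hs' : Summable fun m : I => ‖((‖u m‖ * ‖v m‖ : ℝ) : ℂ)‖ := by
      simpa using hs
    refine Summable.of_nonneg_of_le (fun m => tsum_nonneg fun _ => norm_nonneg _) (fun m => ?_)
      (hasSum_pi_prod (fun _ : Fin n => fun m : I => ((‖u m‖ * ‖v m‖ : ℝ) : ℂ)) fun _ => hs').1
    have hp := hasSum_pi_prod
      (fun k i => ((‖(inner ℂ (u (m k)) (b i) * inner ℂ (b i) (v (m (σ⁻¹ k))) : ℂ)‖ : ℝ) : ℂ))
      fun k => by simpa using summable_norm_inner_mul b (u (m k)) (v (m (σ⁻¹ k)))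
    have hq : ∑' i, ‖F σ m i‖ =
        ∏ k, ∑' i, ‖(inner ℂ (u (m k)) (b i) * inner ℂ (b i) (v (m (σ⁻¹ k))) : ℂ)‖ := by
      have := hp.2.tsum_eq
      simp only [← Complex.ofReal_tsum, ← Complex.ofReal_prod] at this
      rw [← Complex.ofReal_inj.1 this]
      simp only [hF, norm_prod]
    calc ∑' i, ‖F σ m i‖ ≤ ∏ k, (‖u (m k)‖ * ‖v (m (σ⁻¹ k))‖) := by
          rw [hq]
          exact Finset.prod_le_prod (fun _ _ => tsum_nonneg fun _ => norm_nonneg _)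
            fun k _ => tsum_norm_inner_mul_le b _ _
      _ = ∏ k, (‖u (m k)‖ * ‖v (m k)‖) := by
          rw [Finset.prod_mul_distrib, Finset.prod_mul_distrib,
            Equiv.prod_comp σ⁻¹ fun k => ‖v (m k)‖]
      _ = ‖∏ k, ((‖u (m k)‖ * ‖v (m k)‖ : ℝ) : ℂ)‖ := by simp
  have hR : ∀ σ, HasSum (fun m : Fin n → I => ∏ k, (inner ℂ (u (m k)) (v (m (σ⁻¹ k))) : ℂ))
      (∑' p : (Fin n → I) × (Fin n → ι), F σ p.1 p.2) := fun σ =>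
    (h3 σ).hasSum.prod_fiberwise (h2 σ)
  have hL : ∀ σ, HasSum (fun i : Fin n → ι => ∏ k, (inner ℂ (b (i (σ k))) (T (b (i k))) : ℂ))
      (∑' p : (Fin n → I) × (Fin n → ι), F σ p.1 p.2) := fun σ => by
    have := ((Equiv.prodComm _ _).hasSum_iff (f := fun p : (Fin n → I) × (Fin n → ι) =>
      F σ p.1 p.2)).2 (h3 σ).hasSum
    exact this.prod_fiberwise (h1 σ)
  have hdetL := hasSum_sum fun (σ : Equiv.Perm (Fin n)) (_ : σ ∈ Finset.univ) =>
    (hL σ).mul_left (((Equiv.Perm.sign σ : ℤ) : ℂ))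
  have hdetR := hasSum_sum fun (σ : Equiv.Perm (Fin n)) (_ : σ ∈ Finset.univ) =>
    (hR σ).mul_left (((Equiv.Perm.sign σ : ℤ) : ℂ))
  rw [show (fun i : Fin n → ι => Matrix.det
      (Matrix.of fun k l : Fin n => (inner ℂ (b (i k)) (T (b (i l))) : ℂ))) = _ from
    funext fun i => Matrix.det_apply' _]
  refine hdetL.tsum_eq.trans (hdetR.tsum_eq.symm.trans (tsum_congr fun m => ?_))
  rw [← Matrix.det_transpose, Matrix.det_apply', ← Equiv.sum_comp (Equiv.inv _)]
  simp

end Hilbert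

/-! ### Hilbert-Schmidt and trace class factorizations -/

section HilbertSchmidt

variable {H H₁ H₂ H₃ : Type*} [NormedAddCommGroup H] [InnerProductSpace ℂ H]
  [NormedAddCommGroup H₁] [InnerProductSpace ℂ H₁]
  [NormedAddCommGroup H₂] [InnerProductSpace ℂ H₂] [NormedAddCommGroup H₃] [InnerProductSpace ℂ H₃]

theorem hasSum_norm_inner_sq {ι : Type*} (b : HilbertBasis ι ℂ H) (v : H) :
    HasSum (fun i => ‖(inner ℂ (b i) v : ℂ)‖ ^ 2) (‖v‖ ^ 2) := by
  have h := b.hasSum_inner_mul_inner v v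
  have h1 : (inner ℂ v v : ℂ) = ((‖v‖ ^ 2 : ℝ) : ℂ) := by
    rw [inner_self_eq_norm_sq_to_K]
    norm_cast
  have h2 : (fun i => (inner ℂ v (b i) * inner ℂ (b i) v : ℂ)) =
      fun i => ((‖(inner ℂ (b i) v : ℂ)‖ ^ 2 : ℝ) : ℂ) := by
    funext i
    rw [← inner_conj_symm v (b i), mul_comm, Complex.mul_conj, Complex.normSq_eq_norm_sq]
  rw [h1, h2] at h
  exact Complex.hasSum_ofReal.1 h

/-- The Hilbert-Schmidt condition for an operator between two spaces, phrased without a basis: the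
sums `∑ ‖T eᵢ‖²` over finite orthonormal sets are bounded. -/
def FiniteHSNorm (T : H₁ →L[ℂ] H₂) : Prop :=
  ∃ C : ℝ, ∀ s : Finset H₁, Orthonormal ℂ ((↑) : s → H₁) → ∑ e ∈ s, ‖T e‖ ^ 2 ≤ C

theorem FiniteHSNorm.summable {ι : Type*} {T : H₁ →L[ℂ] H₂} (hT : FiniteHSNorm T)
    (b : HilbertBasis ι ℂ H₁) : Summable fun i => ‖T (b i)‖ ^ 2 := by
  classical
  obtain ⟨C, hC⟩ := hT
  refine summable_of_sum_le (c := C) (fun _ => sq_nonneg _) fun s => ?_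
  have hi := b.orthonormal.linearIndependent.injective
  rw [← Finset.sum_image (f := fun e => ‖T e‖ ^ 2) (hi.injOn (s := s))]
  refine hC _ ?_
  have : Orthonormal ℂ ((↑) : Set.range b → H₁) := b.orthonormal.toSubtypeRange
  refine this.comp (fun e : (s.image b : Finset H₁) => ⟨e.1, ?_⟩) fun e f h => ?_
  · obtain ⟨i, _, h⟩ := Finset.mem_image.1 e.2
    exact ⟨i, h⟩
  · exact Subtype.ext (congrArg (fun z : Set.range b => (z : H₁)) h)

theorem FiniteHSNorm.comp_left {T : H₁ →L[ℂ] H₂} (hT : FiniteHSNorm T) (S : H₂ →L[ℂ] H₃) :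
    FiniteHSNorm (S ∘L T) := by
  obtain ⟨C, hC⟩ := hT
  refine ⟨‖S‖ ^ 2 * C, fun s hs => ?_⟩
  calc ∑ e ∈ s, ‖(S ∘L T) e‖ ^ 2 ≤ ∑ e ∈ s, ‖S‖ ^ 2 * ‖T e‖ ^ 2 := by
        refine Finset.sum_le_sum fun e _ => ?_
        rw [← mul_pow]
        gcongr
        exact S.le_opNorm _
    _ ≤ ‖S‖ ^ 2 * C := by
        rw [← Finset.mul_sum]
        gcongr
        exact hC s hs

theorem FiniteHSNorm.isHilbertSchmidt {T : H →L[ℂ] H} (hT : FiniteHSNorm T) :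
    IsHilbertSchmidt T :=
  fun _ b => hT.summable b

theorem comp_pow_succ (A : H₂ →L[ℂ] H₁) (B : H₁ →L[ℂ] H₂) (n : ℕ) :
    (B ∘L A : H₂ →L[ℂ] H₂) ^ (n + 1) = B ∘L (((A ∘L B : H₁ →L[ℂ] H₁) ^ n) ∘L A) := by
  induction n with
  | zero => ext; simp
  | succ n ih =>
    rw [pow_succ, ih, pow_succ (A ∘L B : H₁ →L[ℂ] H₁) n]
    rfl

variable [CompleteSpace H₁] [CompleteSpace H₂]

open ContinuousLinearMap (adjoint)

/-- The adjoint has the same Hilbert-Schmidt norm: `∑ᵢ ‖T† eᵢ‖²` and `∑ⱼ ‖T fⱼ‖²` are both the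
double sum of `|⟨eᵢ, T fⱼ⟩|²`. -/
theorem FiniteHSNorm.summable_adjoint {ι : Type*} {T : H₁ →L[ℂ] H₂} (hT : FiniteHSNorm T)
    (b : HilbertBasis ι ℂ H₂) : Summable fun i => ‖adjoint T (b i)‖ ^ 2 := by
  obtain ⟨w, c, -⟩ := exists_hilbertBasis ℂ H₁
  have hc := hT.summable c
  refine summable_of_sum_le (c := ∑' j, ‖T (c j)‖ ^ 2) (fun _ => sq_nonneg _) fun s => ?_
  have key : ∀ i, HasSum (fun j => ‖(inner ℂ (b i) (T (c j)) : ℂ)‖ ^ 2)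
      (‖adjoint T (b i)‖ ^ 2) := by
    intro i
    have h := hasSum_norm_inner_sq c (adjoint T (b i))
    simpa only [ContinuousLinearMap.adjoint_inner_right, norm_inner_symm (T _)] using h
  have hs := hasSum_sum fun i (_ : i ∈ s) => key i
  rw [← hs.tsum_eq]
  refine hs.summable.tsum_le_tsum (fun j => ?_) hc
  exact b.orthonormal.sum_inner_products_le _

theorem FiniteHSNorm.comp_right [CompleteSpace H] {T : H₁ →L[ℂ] H₂} (hT : FiniteHSNorm T)
    (S : H →L[ℂ] H₁) : FiniteHSNorm (T ∘L S) := by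
  obtain ⟨w, b, -⟩ := exists_hilbertBasis ℂ H₂
  have hb := (hT.summable_adjoint b).mul_left (‖adjoint S‖ ^ 2)
  refine ⟨∑' j, ‖adjoint S‖ ^ 2 * ‖adjoint T (b j)‖ ^ 2, fun s hs => ?_⟩
  have key : ∀ e ∈ s, HasSum (fun j => ‖(inner ℂ (e : H) (adjoint S (adjoint T (b j))) : ℂ)‖ ^ 2)
      (‖(T ∘L S) e‖ ^ 2) := by
    intro e _
    have h := hasSum_norm_inner_sq b ((T ∘L S) e)
    simpa only [ContinuousLinearMap.adjoint_inner_right, ContinuousLinearMap.comp_apply,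
      norm_inner_symm (T (S e))] using h
  have hsum := hasSum_sum key
  rw [← hsum.tsum_eq]
  refine hsum.summable.tsum_le_tsum (fun j => ?_) hb
  have hB : ∑ e ∈ s, ‖(inner ℂ (e : H) (adjoint S (adjoint T (b j))) : ℂ)‖ ^ 2 ≤
      ‖adjoint S (adjoint T (b j))‖ ^ 2 := by
    have := hs.sum_inner_products_le (adjoint S (adjoint T (b j))) (s := Finset.univ)
    rwa [Finset.sum_coe_sort s
      fun e => ‖(inner ℂ (e : H) (adjoint S (adjoint T (b j))) : ℂ)‖ ^ 2] at this
  refine hB.trans ?_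
  rw [← mul_pow]
  gcongr
  exact (adjoint S).le_opNorm _

theorem isTraceClass_of_hasSum {I : Type*} {T : H →L[ℂ] H} (u v : I → H)
    (hs : Summable fun m => ‖u m‖ * ‖v m‖)
    (hT : ∀ g, HasSum (fun m => (inner ℂ (u m) g : ℂ) • v m) (T g)) : IsTraceClass T := by
  classical
  -- only countably many terms are nonzero; number them
  have hc : (Function.support fun m => ‖u m‖ * ‖v m‖).Countable := hs.countable_support
  set S := Function.support fun m => ‖u m‖ * ‖v m‖
  have := hc.to_subtype
  obtain ⟨f, hf⟩ := exists_injective_nat S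
  have hS : ∀ m, m ∉ Set.range ((↑) : S → I) → u m = 0 ∨ v m = 0 := by
    intro m hm
    by_contra! h
    exact hm ⟨⟨m, mul_ne_zero (norm_ne_zero_iff.2 h.1) (norm_ne_zero_iff.2 h.2)⟩, rfl⟩
  have ext : ∀ n, n ∉ Set.range f → Function.extend f (fun m : S => u m) 0 n = 0 := fun n hn =>
    Function.extend_apply' _ _ _ (by simpa using hn)
  refine ⟨Function.extend f (fun m : S => u m) 0, Function.extend f (fun m : S => v m) 0, ?_, ?_⟩
  · rw [← hf.summable_iff fun n hn => by rw [ext n hn]; simp]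
    simpa only [Function.comp_def, hf.extend_apply] using! hs.subtype S
  · intro g
    rw [← hf.hasSum_iff fun n hn => by rw [ext n hn]; simp]
    simp only [Function.comp_def, hf.extend_apply]
    exact (Subtype.val_injective.hasSum_iff fun m hm => by
      rcases hS m hm with h | h <;> simp [h]).2 (hT g)

/-- Expanding the middle variable of `X Y` in a Hilbert basis. -/
theorem hasSum_comp_basis {ι : Type*} (b : HilbertBasis ι ℂ H₂) (X : H₂ →L[ℂ] H₃)
    (Y : H₁ →L[ℂ] H₂) (g : H₁) :
    HasSum (fun i => (inner ℂ (adjoint Y (b i)) g : ℂ) • X (b i)) ((X ∘L Y) g) := by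
  have := (b.hasSum_repr (Y g)).mapL X
  simpa [b.repr_apply_apply, ContinuousLinearMap.adjoint_inner_left] using this

theorem summable_norm_comp_basis {ι : Type*} (b : HilbertBasis ι ℂ H₂) {X : H₂ →L[ℂ] H₃}
    {Y : H₁ →L[ℂ] H₂} (hX : FiniteHSNorm X) (hY : FiniteHSNorm Y) :
    Summable fun i => ‖adjoint Y (b i)‖ * ‖X (b i)‖ := by
  refine Summable.of_nonneg_of_le (fun _ => by positivity) (fun i => ?_)
    ((hY.summable_adjoint b).add (hX.summable b))
  nlinarith [sq_nonneg (‖adjoint Y (b i)‖ - ‖X (b i)‖), sq_nonneg ‖adjoint Y (b i)‖,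
    sq_nonneg ‖X (b i)‖]

theorem isTraceClass_comp [CompleteSpace H] {X : H₁ →L[ℂ] H} {Y : H →L[ℂ] H₁} (hX : FiniteHSNorm X)
    (hY : FiniteHSNorm Y) : IsTraceClass (X ∘L Y) := by
  obtain ⟨w, b, -⟩ := exists_hilbertBasis ℂ H₁
  exact isTraceClass_of_hasSum _ _ (summable_norm_comp_basis b hX hY) (hasSum_comp_basis b X Y)

/-- `det (I + AB) = det (I + BA)` for Hilbert-Schmidt `A` and `B`: with `AB = ∑ ⟨B†eᵢ, ·⟩ A eᵢ`
the determinants expanding `Tr Λⁿ(AB)` are the minors of `BA` in the basis `(eᵢ)`. -/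
theorem fredholmDet_one_add_comp_comm {A : H₂ →L[ℂ] H₁} {B : H₁ →L[ℂ] H₂} (hA : FiniteHSNorm A)
    (hB : FiniteHSNorm B) : fredholmDet (1 + A ∘L B) = fredholmDet (1 + B ∘L A) := by
  unfold fredholmDet
  refine tsum_congr fun n => ?_
  rw [add_sub_cancel_left, add_sub_cancel_left]
  set b := (exists_hilbertBasis ℂ H₂).choose_spec.choose
  rw [traceExteriorPower_eq_tsum_det _ (A ∘L B) _ _ (summable_norm_comp_basis b hA hB)
    (hasSum_comp_basis b A B)]
  simp only [traceExteriorPower, ContinuousLinearMap.adjoint_inner_left,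
    ContinuousLinearMap.comp_apply]

/-- `det (I + AC) = det (I + CA)` for bounded `A` and nuclear `C = ∑ ⟨uₘ, ·⟩ vₘ`: both sides are
the series in the determinants of `⟨uₖ, A vₗ⟩`. -/
theorem nuclear_comp_comm {I : Type*} (A : H₂ →L[ℂ] H₁) {C : H₁ →L[ℂ] H₂} (u : I → H₁) (v : I → H₂)
    (hs : Summable fun m => ‖u m‖ * ‖v m‖)
    (hC : ∀ g, HasSum (fun m => (inner ℂ (u m) g : ℂ) • v m) (C g)) :
    IsTraceClass (A ∘L C) ∧ IsTraceClass (C ∘L A) ∧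
      fredholmDet (1 + A ∘L C) = fredholmDet (1 + C ∘L A) := by
  have hs1 : Summable fun m => ‖u m‖ * ‖A (v m)‖ := by
    refine Summable.of_nonneg_of_le (fun _ => by positivity) (fun m => ?_) (hs.mul_left ‖A‖)
    calc ‖u m‖ * ‖A (v m)‖ ≤ ‖u m‖ * (‖A‖ * ‖v m‖) := by gcongr; exact A.le_opNorm _
      _ = _ := by ring
  have hs2 : Summable fun m => ‖adjoint A (u m)‖ * ‖v m‖ := by
    refine Summable.of_nonneg_of_le (fun _ => by positivity) (fun m => ?_) (hs.mul_left ‖adjoint A‖)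
    calc ‖adjoint A (u m)‖ * ‖v m‖ ≤ (‖adjoint A‖ * ‖u m‖) * ‖v m‖ := by
          gcongr; exact (adjoint A).le_opNorm _
      _ = _ := by ring
  have h1 : ∀ g, HasSum (fun m => (inner ℂ (u m) g : ℂ) • A (v m)) ((A ∘L C) g) := fun g => by
    simpa using (hC g).mapL A
  have h2 : ∀ g, HasSum (fun m => (inner ℂ (adjoint A (u m)) g : ℂ) • v m) ((C ∘L A) g) :=
    fun g => by simpa [ContinuousLinearMap.adjoint_inner_left] using hC (A g)
  refine ⟨isTraceClass_of_hasSum _ _ hs1 h1, isTraceClass_of_hasSum _ _ hs2 h2, ?_⟩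
  unfold fredholmDet
  refine tsum_congr fun n => ?_
  rw [add_sub_cancel_left, add_sub_cancel_left, traceExteriorPower_eq_tsum_det _ _ _ _ hs1 h1,
    traceExteriorPower_eq_tsum_det _ _ _ _ hs2 h2]
  simp only [ContinuousLinearMap.adjoint_inner_left]

end HilbertSchmidt

/-! ### The 2-regularized determinant -/

section Regularized

variable {H₁ H₂ : Type*} [NormedAddCommGroup H₁] [InnerProductSpace ℂ H₁] [CompleteSpace H₁]
  [NormedAddCommGroup H₂] [InnerProductSpace ℂ H₂] [CompleteSpace H₂]

/-- `e^z = 1 + z + z² ψ(z)` for operators, with `e^{BA}` expressed through `Ψ = ψ(AB)` as well. -/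
theorem exists_exp_comp (A : H₂ →L[ℂ] H₁) (B : H₁ →L[ℂ] H₂) :
    ∃ Ψ : H₁ →L[ℂ] H₁, (A ∘L B) * Ψ = Ψ * (A ∘L B) ∧
      NormedSpace.exp (A ∘L B) = 1 + A ∘L B + (A ∘L B) * ((A ∘L B) * Ψ) ∧
      NormedSpace.exp (B ∘L A) = 1 + B ∘L A + B ∘L (((A ∘L B) * Ψ) ∘L A) := by
  set K := A ∘L B with hK
  have hs : Summable fun n : ℕ => ((n + 2).factorial : ℂ)⁻¹ • K ^ n := by
    refine Summable.of_norm (Summable.of_nonneg_of_le (fun _ => norm_nonneg _) (fun n => ?_)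
      (NormedSpace.norm_expSeries_summable' (𝕂 := ℂ) K))
    rw [norm_smul, norm_smul]
    gcongr
    simp only [norm_inv, Complex.norm_natCast]
    gcongr
    omega
  obtain ⟨Ψ, hΨ⟩ := hs
  have e1 := (hasSum_nat_add_iff' 2).2 (NormedSpace.exp_series_hasSum_exp' (𝕂 := ℂ) K)
  have e2 := (hasSum_nat_add_iff' 2).2 (NormedSpace.exp_series_hasSum_exp' (𝕂 := ℂ) (B ∘L A))
  simp only [Finset.sum_range_succ, Finset.sum_range_zero] at e1 e2
  refine ⟨Ψ, ?_, ?_, ?_⟩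
  · refine (hΨ.mul_left K).unique ?_
    convert! hΨ.mul_right K using 2 with n
    rw [mul_smul_comm, smul_mul_assoc, ← pow_succ, ← pow_succ']
  · have : HasSum (fun n : ℕ => ((n + 2).factorial : ℂ)⁻¹ • K ^ (n + 2)) (K * (K * Ψ)) := by
      convert! (hΨ.mul_left K).mul_left K using 2 with n
      rw [mul_smul_comm, mul_smul_comm, ← pow_succ', ← pow_succ']
    rw [this.unique e1]
    simp
  · let φ : (H₁ →L[ℂ] H₁) →L[ℂ] (H₂ →L[ℂ] H₂) :=
      ContinuousLinearMap.compL ℂ H₂ H₁ H₂ B ∘L (ContinuousLinearMap.compL ℂ H₂ H₁ H₁).flip A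
    have hφ : ∀ Z, φ Z = B ∘L (Z ∘L A) := fun Z => rfl
    have : HasSum (fun n : ℕ => ((n + 2).factorial : ℂ)⁻¹ • (B ∘L A : H₂ →L[ℂ] H₂) ^ (n + 2))
        (φ (K * Ψ)) := by
      convert! (hΨ.mul_left K).mapL φ using 2 with n
      rw [comp_pow_succ, mul_smul_comm, map_smul, hφ, ← pow_succ']
    rw [← hφ, this.unique e2]
    simp

/-- `T ↦ (I + T) e^{-T} - I` vanishes to second order, so its values at `AB` and `BA` are `A C` and
`C A` with `C = B Q A B` nuclear as soon as `B` is Hilbert-Schmidt. -/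
theorem fredholmDet₂_one_add_comp_comm (A : H₂ →L[ℂ] H₁) {B : H₁ →L[ℂ] H₂} (hB : FiniteHSNorm B) :
    IsTraceClass ((1 + A ∘L B) * NormedSpace.exp (-(A ∘L B)) - 1) ∧
    IsTraceClass ((1 + B ∘L A) * NormedSpace.exp (-(B ∘L A)) - 1) ∧
      fredholmDet₂ (1 + A ∘L B) = fredholmDet₂ (1 + B ∘L A) := by
  obtain ⟨P, rfl⟩ : ∃ P, A = -P := ⟨-A, by simp⟩
  obtain ⟨Ψ, h1, h2, h3⟩ := exists_exp_comp P B
  simp only [fredholmDet₂, add_sub_cancel_left, ContinuousLinearMap.neg_comp,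
    ContinuousLinearMap.comp_neg, neg_neg, h2, h3]
  set Q : H₁ →L[ℂ] H₁ := -1 + Ψ - (P ∘L B) * Ψ with hQ
  have hΨ : Commute (P ∘L B) Ψ := h1
  have hKQ : (P ∘L B) * Q = Q * (P ∘L B) :=
    (((Commute.one_right _).neg_right.add_right hΨ).sub_right
      ((Commute.refl (P ∘L B)).mul_right hΨ)).eq
  -- with `K = PB`, `(1 - K) (1 + K + K² Ψ) - 1 = K Q K`
  set C : H₁ →L[ℂ] H₂ := B ∘L (Q ∘L (P ∘L B)) with hC
  have e1 : (1 + -(P ∘L B)) * (1 + P ∘L B + (P ∘L B) * ((P ∘L B) * Ψ)) = 1 + P ∘L C := by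
    have : P ∘L C = (P ∘L B) * (Q * (P ∘L B)) := rfl
    rw [this, ← hKQ, hQ]
    noncomm_ring
  have e2 : (1 + -(B ∘L P)) * (1 + B ∘L P + B ∘L (((P ∘L B) * Ψ) ∘L P)) = 1 + C ∘L P := by
    have : C ∘L P = B ∘L ((Q * (P ∘L B)) ∘L P) := rfl
    rw [this, ← hKQ, hQ]
    ext g
    simp
    abel
  obtain ⟨w, b, -⟩ := exists_hilbertBasis ℂ H₁
  have hY : FiniteHSNorm (Q ∘L (P ∘L B)) := (hB.comp_left P).comp_left Q
  have := nuclear_comp_comm P _ _ (summable_norm_comp_basis b hB hY) (hasSum_comp_basis b B _)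
  rw [e1, e2, add_sub_cancel_left, add_sub_cancel_left]
  exact this

end Regularized

/-! ### Hilbert-Schmidt integral operators -/

section KernelOperators

variable {μ ν : Measure ℝ}

theorem L2_norm_sq_eq_integral (f : Lp ℂ 2 μ) : ‖f‖ ^ 2 = ∫ t, ‖f t‖ ^ 2 ∂μ := by
  have h := inner_self_eq_norm_sq_to_K (𝕜 := ℂ) f
  rw [L2.inner_def] at h
  simp only [inner_self_eq_norm_sq_to_K] at h
  have h2 : ((∫ t, ‖f t‖ ^ 2 ∂μ : ℝ) : ℂ) = ((‖f‖ ^ 2 : ℝ) : ℂ) := by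
    rw [← integral_complex_ofReal]
    push_cast
    exact h
  exact (Complex.ofReal_injective h2).symm

/-- An operator of the form `(T g)(t) = m(t) ⟨kₜ, g⟩` with `m ∈ L²` and bounded `kₜ` is
Hilbert-Schmidt, by Bessel's inequality under the integral. -/
theorem finiteHSNorm_of_ae_eq_mul_inner {H : Type*} [NormedAddCommGroup H] [InnerProductSpace ℂ H]
    {T : H →L[ℂ] Lp ℂ 2 μ} {m : ℝ → ℂ} (hm : MemLp m 2 μ) {k : ℝ → H} {C : ℝ} (hk : ∀ t, ‖k t‖ ≤ C)
    (hT : ∀ g, T g =ᵐ[μ] fun t => m t * inner ℂ (k t) g) : FiniteHSNorm T := by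
  refine ⟨∫ t, ‖m t‖ ^ 2 * C ^ 2 ∂μ, fun s hs => ?_⟩
  have hi : ∀ e : H, Integrable (fun t => ‖T e t‖ ^ 2) μ := fun e =>
    (Lp.memLp (T e)).integrable_norm_pow two_ne_zero
  simp only [L2_norm_sq_eq_integral]
  rw [← integral_finsetSum _ fun e _ => hi e]
  refine integral_mono_ae (integrable_finsetSum _ fun e _ => hi e)
    ((hm.integrable_norm_pow two_ne_zero).mul_const _) ?_
  have hall : ∀ᵐ t ∂μ, ∀ e ∈ s, T e t = m t * inner ℂ (k t) e :=
    (Finset.eventually_all s).2 fun e _ => hT e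
  filter_upwards [hall] with t ht
  have hB : ∑ e ∈ s, ‖(inner ℂ e (k t) : ℂ)‖ ^ 2 ≤ ‖k t‖ ^ 2 := by
    have := hs.sum_inner_products_le (k t) (s := Finset.univ)
    rwa [Finset.sum_coe_sort s fun e => ‖(inner ℂ (e : H) (k t) : ℂ)‖ ^ 2] at this
  calc ∑ e ∈ s, ‖T e t‖ ^ 2 = ‖m t‖ ^ 2 * ∑ e ∈ s, ‖(inner ℂ e (k t) : ℂ)‖ ^ 2 := by
        rw [Finset.mul_sum]
        refine Finset.sum_congr rfl fun e he => ?_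
        rw [ht e he, norm_mul, mul_pow, norm_inner_symm]
    _ ≤ ‖m t‖ ^ 2 * C ^ 2 := by
        have := hk t
        gcongr
        exact hB.trans (by gcongr)

/-- The integral operator with kernel `m(t) w(t, s) q(s)`, where `w` is bounded and continuous and
`m`, `q` are square integrable, exists and is Hilbert-Schmidt. -/
theorem exists_kernelOperator [SFinite μ] [SFinite ν] {w : ℝ → ℝ → ℂ}
    (hw : Continuous (Function.uncurry w)) (hw1 : ∀ t s, ‖w t s‖ ≤ 1) {m q : ℝ → ℂ}
    (hm : MemLp m 2 μ) (hq : MemLp q 2 ν) :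
    ∃ T : Lp ℂ 2 ν →L[ℂ] Lp ℂ 2 μ, FiniteHSNorm T ∧
      ∀ g, T g =ᵐ[μ] fun t => m t * ∫ s, w t s * (q s * g s) ∂ν := by
  have hwt : ∀ t, AEStronglyMeasurable (w t) ν := fun t =>
    (hw.comp (Continuous.prodMk_right t)).aestronglyMeasurable
  have hk0 : ∀ t, MemLp (fun s => starRingEnd ℂ (w t s * q s)) 2 ν := fun t =>
    hq.of_le (Complex.continuous_conj.comp_aestronglyMeasurable ((hwt t).mul hq.1))
      (Filter.Eventually.of_forall fun s => by
        simpa using mul_le_mul_of_nonneg_right (hw1 t s) (norm_nonneg (q s)))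
  set k : ℝ → Lp ℂ 2 ν := fun t => (hk0 t).toLp with hk
  have hkn : ∀ t, ‖k t‖ ≤ ‖hq.toLp‖ := fun t => by
    refine Lp.norm_le_norm_of_ae_le ?_
    filter_upwards [(hk0 t).coeFn_toLp, hq.coeFn_toLp] with s h1 h2
    rw [h1, h2]
    simpa using mul_le_mul_of_nonneg_right (hw1 t s) (norm_nonneg (q s))
  have hin : ∀ t g, (inner ℂ (k t) g : ℂ) = ∫ s, w t s * (q s * g s) ∂ν := fun t g => by
    rw [L2.inner_def]
    refine integral_congr_ae ?_
    filter_upwards [(hk0 t).coeFn_toLp] with s h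
    rw [hk, h, RCLike.inner_apply, Complex.conj_conj]
    ring
  have hmeas : ∀ g : Lp ℂ 2 ν, AEStronglyMeasurable (fun t => (inner ℂ (k t) g : ℂ)) μ := by
    intro g
    simp only [hin]
    refine AEStronglyMeasurable.integral_prod_right'
      (f := fun p : ℝ × ℝ => w p.1 p.2 * (q p.2 * g p.2)) ?_
    exact hw.aestronglyMeasurable.mul (hq.1.mul (Lp.aestronglyMeasurable g)).comp_snd
  have hle : ∀ g : Lp ℂ 2 ν, ∀ t, ‖m t * inner ℂ (k t) g‖ ≤ (‖hq.toLp‖ * ‖g‖) * ‖m t‖ := by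
    intro g t
    rw [norm_mul, mul_comm]
    gcongr
    exact (norm_inner_le_norm _ _).trans (by gcongr; exact hkn t)
  have hT0 : ∀ g : Lp ℂ 2 ν, MemLp (fun t => m t * inner ℂ (k t) g) 2 μ := fun g =>
    hm.of_le_mul (hm.1.mul (hmeas g)) (Filter.Eventually.of_forall (hle g))
  let T : Lp ℂ 2 ν →ₗ[ℂ] Lp ℂ 2 μ :=
    { toFun := fun g => (hT0 g).toLp
      map_add' := fun g h => by
        rw [← MemLp.toLp_add]
        refine MemLp.toLp_congr _ _ (Filter.Eventually.of_forall fun t => ?_)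
        simp [inner_add_right, mul_add]
      map_smul' := fun c g => by
        rw [RingHom.id_apply, ← MemLp.toLp_const_smul]
        refine MemLp.toLp_congr _ _ (Filter.Eventually.of_forall fun t => ?_)
        simp [inner_smul_right, mul_left_comm] }
  have hTle : ∀ g, ‖T g‖ ≤ (‖hq.toLp‖ * ‖hm.toLp‖) * ‖g‖ := fun g => by
    have : ‖T g‖ ≤ (‖hq.toLp‖ * ‖g‖) * ‖hm.toLp‖ := by
      refine Lp.norm_le_mul_norm_of_ae_le_mul ?_
      filter_upwards [(hT0 g).coeFn_toLp, hm.coeFn_toLp] with t h1 h2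
      rw [h2]
      exact (congrArg norm h1).trans_le (hle g t)
    linarith
  refine ⟨T.mkContinuous _ hTle, ?_, fun g => ?_⟩
  · exact finiteHSNorm_of_ae_eq_mul_inner hm hkn fun g => (hT0 g).coeFn_toLp
  · exact (hT0 g).coeFn_toLp.trans
      (Filter.Eventually.of_forall fun t => congrArg (m t * ·) (hin t g))

theorem integrable_prod_kernel [SFinite μ] [SFinite ν] {w : ℝ → ℝ → ℂ}
    (hw : Continuous (Function.uncurry w)) (hw1 : ∀ t s, ‖w t s‖ ≤ 1) {f g : ℝ → ℂ}
    (hf : Integrable f μ) (hg : Integrable g ν) :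
    Integrable (fun p : ℝ × ℝ => w p.1 p.2 * (f p.1 * g p.2)) (μ.prod ν) :=
  (hf.mul_prod hg).bdd_mul (c := 1) hw.aestronglyMeasurable
    (Filter.Eventually.of_forall fun p => hw1 p.1 p.2)

/-- Fubini's theorem for a bounded continuous kernel, arranged as an integral operator. -/
theorem integral_mul_integral_kernel [SFinite μ] [SFinite ν] {w : ℝ → ℝ → ℂ}
    (hw : Continuous (Function.uncurry w)) (hw1 : ∀ t s, ‖w t s‖ ≤ 1) {f g : ℝ → ℂ}
    (hf : Integrable f μ) (hg : Integrable g ν) :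
    Integrable (fun s => (∫ t, w t s * f t ∂μ) * g s) ν ∧
      ∫ t, f t * (∫ s, w t s * g s ∂ν) ∂μ = ∫ s, (∫ t, w t s * f t ∂μ) * g s ∂ν := by
  have h := integrable_prod_kernel hw hw1 hf hg
  have e : ∀ s, (∫ t, w t s * f t ∂μ) * g s = ∫ t, w t s * (f t * g s) ∂μ := fun s => by
    rw [← integral_mul_const]
    simp only [mul_assoc]
  simp only [e]
  refine ⟨h.integral_prod_right, ?_⟩
  rw [← integral_integral_swap (f := fun t s => w t s * (f t * g s)) h]
  refine integral_congr_ae (Filter.Eventually.of_forall fun t => ?_)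
  simp only [← integral_const_mul]
  congr 1 with s
  ring

end KernelOperators

/-! ### Plane waves and the sine kernel -/

section Waves

/-- The plane wave `e^{iξ(t - x/2)}`, with the phase centred on the segment `[0, x]`. -/
noncomputable def wave (x ξ t : ℝ) : ℂ := Complex.exp (((ξ * (t - x / 2) : ℝ) : ℂ) * Complex.I)

theorem norm_wave (x ξ t : ℝ) : ‖wave x ξ t‖ = 1 := Complex.norm_exp_ofReal_mul_I _

theorem continuous_wave (x : ℝ) : Continuous (Function.uncurry (wave x)) := by
  unfold wave Function.uncurry
  fun_prop

theorem wave_mul_wave (x ξ η t : ℝ) : wave x ξ t * wave x (-η) t = wave x (ξ - η) t := by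
  simp only [wave, ← Complex.exp_add]
  push_cast
  ring_nf

theorem wave_neg_mul_wave (x ξ t s : ℝ) :
    wave x (-ξ) t * wave x ξ s = Complex.exp (-Complex.I * ((t - s : ℝ) : ℂ) * ξ) := by
  simp only [wave, ← Complex.exp_add]
  push_cast
  ring_nf

/-- The sine kernel is the normalized integral of a plane wave over the segment. -/
theorem integral_wave {x : ℝ} (hx : 0 < x) (ξ η : ℝ) :
    (1 / (2 * Real.pi) : ℂ) * ∫ t, wave x (ξ - η) t ∂segment x = sineKernel x ξ η := by
  rw [segment, integral_Icc_eq_integral_Ioc, ← intervalIntegral.integral_of_le hx.le]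
  by_cases h : ξ = η
  · subst h
    simp [wave, sineKernel]
    ring
  · have hc : ((ξ - η : ℝ) : ℂ) * Complex.I ≠ 0 :=
      mul_ne_zero (by exact_mod_cast sub_ne_zero.2 h) Complex.I_ne_zero
    have hd : (ξ : ℂ) - η ≠ 0 := by exact_mod_cast sub_ne_zero.2 h
    have hpi : (Real.pi : ℂ) ≠ 0 := by exact_mod_cast Real.pi_ne_zero
    have e : ∀ t : ℝ, wave x (ξ - η) t =
        Complex.exp (-(((ξ - η : ℝ) : ℂ) * Complex.I) * (x / 2)) *
          Complex.exp (((ξ - η : ℝ) : ℂ) * Complex.I * t) := by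
      intro t
      simp only [wave, ← Complex.exp_add]
      push_cast
      ring_nf
    simp only [e, intervalIntegral.integral_const_mul, integral_exp_mul_complex hc, sineKernel,
      if_neg h]
    rw [mul_div_assoc', mul_sub, ← Complex.exp_add, ← Complex.exp_add]
    push_cast
    field_simp
    ring_nf

end Waves

/-! ### Integrable symbols -/

section IntegrableSymbol

theorem integrable_mul_of_memLp_two {μ : Measure ℝ} {f g : ℝ → ℂ} (hf : MemLp f 2 μ)
    (hg : MemLp g 2 μ) : Integrable (fun t => f t * g t) μ :=
  hf.integrable_mul hg

theorem exists_operators_of_integrable_symbol {x : ℝ} (hx : 0 < x) {σ r : ℝ → ℂ}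
    (hσ : MemLp (fun ξ => σ ξ - 1) 1 (volume : Measure ℝ))
    (hr : AEStronglyMeasurable r (volume : Measure ℝ)) (hrσ : ∀ ξ, r ξ ^ 2 = σ ξ - 1) :
    ∃ (K : Lp ℂ 2 (segment x) →L[ℂ] Lp ℂ 2 (segment x))
      (V : Lp ℂ 2 (volume : Measure ℝ) →L[ℂ] Lp ℂ 2 (volume : Measure ℝ)),
      IsIntegralOperator (segment x) (fun t t' => fourierInvL1 (fun ξ => σ ξ - 1) (t - t')) K ∧
      IsIntegralOperator volume (kernelV1 x r) V ∧ IsTraceClass K ∧ IsTraceClass V ∧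
      fredholmDet (1 + K) = fredholmDet (1 + V) := by
  have hr2 : MemLp r 2 volume := by
    rw [← integrable_norm_rpow_iff hr two_ne_zero ENNReal.ofNat_ne_top]
    have := (memLp_one_iff_integrable.1 hσ).norm
    refine this.congr (Filter.Eventually.of_forall fun ξ => ?_)
    simp [← hrσ]
  have hrr : Integrable (fun ξ => r ξ * r ξ) volume := integrable_mul_of_memLp_two hr2 hr2
  have hconst : ∀ c : ℂ, MemLp (fun _ : ℝ => c) 2 (segment x) := fun c => memLp_const c
  have hw : Continuous (Function.uncurry fun t ξ => wave x (-ξ) t) := by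
    unfold wave Function.uncurry
    fun_prop
  obtain ⟨A, hA, hA'⟩ := exists_kernelOperator (μ := segment x) (ν := volume) hw
    (fun t ξ => (norm_wave x (-ξ) t).le) (hconst (1 / (2 * Real.pi))) hr2
  obtain ⟨B, hB, hB'⟩ := exists_kernelOperator (μ := volume) (ν := segment x) (continuous_wave x)
    (fun ξ t => (norm_wave x ξ t).le) hr2 (hconst 1)
  simp only [one_mul] at hB'
  refine ⟨A ∘L B, B ∘L A, fun g => ?_, fun g => ?_, isTraceClass_comp hA hB,
    isTraceClass_comp hB hA, fredholmDet_one_add_comp_comm hA hB⟩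
  · have hg : Integrable g (segment x) := (Lp.memLp g).integrable one_le_two
    filter_upwards [hA' (B g)] with t ht
    have hw2 : Continuous (Function.uncurry fun ξ s => wave x (-ξ) t * wave x ξ s) := by
      unfold wave Function.uncurry
      fun_prop
    obtain ⟨h1, h2⟩ := integral_mul_integral_kernel (μ := volume) hw2
      (fun ξ s => by simp [norm_wave]) hrr hg
    have hk : ∀ s, fourierInvL1 (fun ξ => σ ξ - 1) (t - s) = 1 / (2 * Real.pi) *
        ∫ ξ, wave x (-ξ) t * wave x ξ s * (r ξ * r ξ) := fun s => by
      simp only [fourierInvL1, wave_neg_mul_wave, ← hrσ]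
      congr 2 with ξ
      ring
    simp only [hk, mul_assoc (1 / (2 * Real.pi) : ℂ), integral_const_mul]
    refine ⟨h1.const_mul _, ?_⟩
    rw [← h2, ContinuousLinearMap.comp_apply, ht]
    congr 1
    refine integral_congr_ae ?_
    filter_upwards [hB' g] with ξ hξ
    rw [hξ]
    simp only [mul_assoc, integral_const_mul]
    ring
  · have hg : Integrable (fun ξ => r ξ * g ξ) volume :=
      integrable_mul_of_memLp_two hr2 (Lp.memLp g)
    filter_upwards [hB' (A g)] with ξ hξ
    have hw2 : Continuous (Function.uncurry fun t η => wave x ξ t * wave x (-η) t) := by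
      unfold wave Function.uncurry
      fun_prop
    obtain ⟨h1, h2⟩ := integral_mul_integral_kernel (μ := segment x) hw2
      (fun t η => by simp [norm_wave]) (f := fun _ => (1 / (2 * Real.pi) : ℂ))
      (integrable_const _) hg
    have hk : ∀ η, (∫ t, wave x ξ t * wave x (-η) t * (1 / (2 * Real.pi) : ℂ) ∂segment x) =
        sineKernel x ξ η := fun η => by
      simp only [wave_mul_wave, ← integral_wave hx, mul_comm _ (1 / (2 * Real.pi) : ℂ),
        integral_const_mul]
    simp only [hk] at h1 h2
    have e : ∀ η, kernelV1 x r ξ η * g η = r ξ * (sineKernel x ξ η * (r η * g η)) := fun η => by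
      simp only [kernelV1]
      ring
    simp only [e, integral_const_mul]
    refine ⟨h1.const_mul _, ?_⟩
    rw [← h2, ContinuousLinearMap.comp_apply, hξ]
    congr 1
    refine integral_congr_ae ?_
    filter_upwards [hA' g] with t ht
    rw [ht]
    simp only [mul_assoc, integral_const_mul]
    ring

end IntegrableSymbol

/-! ### The Fourier transform on `L²(ℝ)` -/

section Plancherel

open scoped FourierTransform SchwartzMap ContDiff

theorem integral_schwartz_mul_fourier (φ : 𝓢(ℝ, ℂ)) (f : Lp ℂ 2 (volume : Measure ℝ)) :
    ∫ t, φ t * (𝓕 f : Lp ℂ 2 (volume : Measure ℝ)) t = ∫ t, (𝓕 φ : 𝓢(ℝ, ℂ)) t * f t := by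
  have h := congrArg (fun T => T φ) (Lp.fourier_toTemperedDistribution_eq f)
  simpa [Lp.toTemperedDistribution_apply] using h.symm

/-- The multiplication formula `∫ 𝓕f · g = ∫ f · 𝓕g` for square integrable functions. -/
theorem integral_fourier_mul_Lp (f g : Lp ℂ 2 (volume : Measure ℝ)) :
    ∫ t, (𝓕 f : Lp ℂ 2 (volume : Measure ℝ)) t * g t =
      ∫ t, f t * (𝓕 g : Lp ℂ 2 (volume : Measure ℝ)) t := by
  let Φ := (ContinuousLinearMap.mul ℂ ℂ).lpPairing (volume : Measure ℝ) 2 2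
  have hΦ : ∀ u v, Φ u v = ∫ t, u t * v t := fun u v => by
    simp [Φ, ContinuousLinearMap.lpPairing_eq_integral]
  rw [← hΦ, ← hΦ]
  refine DenseRange.induction_on (p := fun g => Φ (𝓕 f) g = Φ f (𝓕 g))
    (SchwartzMap.denseRange_toLpCLM (E := ℝ) (F := ℂ) (p := 2) (μ := volume) ENNReal.ofNat_ne_top)
    g ?_ fun φ => ?_
  · exact isClosed_eq (Φ (𝓕 f)).continuous
      ((Φ f).continuous.comp (Lp.fourierTransformₗᵢ ℝ ℂ).continuous)
  · have e : SchwartzMap.toLpCLM ℝ ℂ 2 volume φ = φ.toLp 2 := rfl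
    rw [e, SchwartzMap.toLp_fourier_eq, hΦ, hΦ]
    have h := integral_schwartz_mul_fourier φ f
    refine Eq.trans (integral_congr_ae ?_) (h.trans (integral_congr_ae ?_))
    · filter_upwards [φ.coeFn_toLp 2] with t ht
      rw [ht, mul_comm]
    · filter_upwards [(𝓕 φ : 𝓢(ℝ, ℂ)).coeFn_toLp 2] with t ht
      rw [ht, mul_comm]

/-- On `L¹ ∩ L²` the Fourier transform of `L²` is given by the Fourier integral. -/
theorem fourier_toLp_ae_eq {f : ℝ → ℂ} (hf1 : Integrable f) (hf2 : MemLp f 2 volume) :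
    (𝓕 hf2.toLp : Lp ℂ 2 (volume : Measure ℝ)) =ᵐ[volume] 𝓕 f := by
  have hcont : Continuous (𝓕 f) :=
    VectorFourier.fourierIntegral_continuous Real.continuous_fourierChar (by fun_prop) hf1
  refine ae_eq_of_integral_contDiff_smul_eq
    ((Lp.memLp _).locallyIntegrable one_le_two) hcont.locallyIntegrable fun g hg hgs => ?_
  have hgC : ContDiff ℝ ∞ fun t => (g t : ℂ) := Complex.ofRealCLM.contDiff.comp hg
  have hgCs : HasCompactSupport fun t => (g t : ℂ) := hgs.comp_left Complex.ofReal_zero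
  set φ : 𝓢(ℝ, ℂ) := hgCs.toSchwartzMap hgC with hφ
  have hφg : ∀ t, φ t = g t := fun t => rfl
  have h1 := integral_schwartz_mul_fourier φ hf2.toLp
  have h2 : ∫ t, (𝓕 (φ : ℝ → ℂ)) t • f t = ∫ t, φ t • 𝓕 f t := by
    have h := VectorFourier.integral_fourierIntegral_smul_eq_flip (L := innerₗ ℝ) (μ := volume)
      Real.continuous_fourierChar continuous_inner φ.integrable hf1
    rwa [flip_innerₗ] at h
  simp only [Complex.real_smul, ← hφg]
  rw [h1]
  refine Eq.trans (integral_congr_ae ?_) h2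
  filter_upwards [hf2.coeFn_toLp] with t ht
  rw [ht, SchwartzMap.fourier_coe, smul_eq_mul]

/-- The multiplication formula against a function of `L¹ ∩ L²`, whose transform is an integral. -/
theorem integral_fourier_mul_eq {G : ℝ → ℂ} (hG1 : Integrable G) (hG2 : MemLp G 2 volume)
    (f : Lp ℂ 2 (volume : Measure ℝ)) :
    MemLp (𝓕 G) 2 (volume : Measure ℝ) ∧
      ∫ t, (𝓕 f : Lp ℂ 2 (volume : Measure ℝ)) t * G t = ∫ t, f t * 𝓕 G t := by
  have h := fourier_toLp_ae_eq hG1 hG2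
  refine ⟨(memLp_congr_ae h).1 (Lp.memLp _), ?_⟩
  refine Eq.trans (integral_congr_ae ?_) ((integral_fourier_mul_Lp f hG2.toLp).trans
    (integral_congr_ae ?_))
  · filter_upwards [hG2.coeFn_toLp] with t ht
    rw [ht]
  · filter_upwards [h] with t ht
    rw [ht]

end Plancherel

/-! ### Affine changes of variable -/

section Affine

theorem map_volume_affine {a : ℝ} (ha : a ≠ 0) (c : ℝ) :
    Measure.map (fun t : ℝ => a * t + c) volume = ENNReal.ofReal |a⁻¹| • volume := by
  have h : (fun t : ℝ => a * t + c) = (fun t => t + c) ∘ fun t => a * t := rfl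
  rw [h, ← Measure.map_map (by fun_prop) (by fun_prop), Real.map_volume_mul_left ha,
    Measure.map_smul, map_add_right_eq_self]

theorem quasiMeasurePreserving_affine {a : ℝ} (ha : a ≠ 0) (c : ℝ) :
    Measure.QuasiMeasurePreserving (fun t : ℝ => a * t + c) volume volume :=
  ⟨by fun_prop, by
    rw [map_volume_affine ha]
    exact Measure.smul_absolutelyContinuous⟩

theorem integral_comp_affine (f : ℝ → ℂ) (a c : ℝ) :
    ∫ t, f (a * t + c) = |a⁻¹| • ∫ t, f t := by
  rw [Measure.integral_comp_mul_left (fun t => f (t + c)) a, integral_add_right_eq_self]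

theorem memLp_comp_affine {f : ℝ → ℂ} {p : ENNReal} (hf : MemLp f p volume) {a : ℝ} (ha : a ≠ 0)
    (c : ℝ) : MemLp (fun t => f (a * t + c)) p volume := by
  refine MemLp.comp_of_map (g := f) (f := fun t : ℝ => a * t + c) ?_ (by fun_prop)
  rw [map_volume_affine ha]
  exact hf.smul_measure ENNReal.ofReal_ne_top

theorem exists_affineComposition {a : ℝ} (ha : a ≠ 0) (c : ℝ) :
    ∃ S : Lp ℂ 2 (volume : Measure ℝ) →L[ℂ] Lp ℂ 2 (volume : Measure ℝ),
      ∀ g, S g =ᵐ[volume] fun t => g (a * t + c) := by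
  have h0 : ∀ g : Lp ℂ 2 (volume : Measure ℝ), MemLp (fun t => g (a * t + c)) 2 volume := fun g =>
    memLp_comp_affine (Lp.memLp g) ha c
  have hq := quasiMeasurePreserving_affine ha c
  let S : Lp ℂ 2 (volume : Measure ℝ) →ₗ[ℂ] Lp ℂ 2 (volume : Measure ℝ) :=
    { toFun := fun g => (h0 g).toLp
      map_add' := fun g h => by
        rw [← MemLp.toLp_add]
        exact MemLp.toLp_congr _ _ (hq.ae (Lp.coeFn_add g h))
      map_smul' := fun z g => by
        rw [RingHom.id_apply, ← MemLp.toLp_const_smul]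
        exact MemLp.toLp_congr _ _ (hq.ae (Lp.coeFn_smul z g)) }
  have hS : ∀ g, ‖S g‖ ≤ (ENNReal.ofReal |a⁻¹| ^ (1 / 2 : ENNReal).toReal).toReal * ‖g‖ := by
    intro g
    have : eLpNorm (fun t => g (a * t + c)) 2 volume =
        ENNReal.ofReal |a⁻¹| ^ (1 / 2 : ENNReal).toReal * eLpNorm g 2 volume := by
      have hm : AEStronglyMeasurable g (Measure.map (fun t : ℝ => a * t + c) volume) :=
        (Lp.stronglyMeasurable g).aestronglyMeasurable
      rw [← smul_eq_mul, ← eLpNorm_smul_measure_of_ne_top ENNReal.ofNat_ne_top,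
        ← map_volume_affine ha c, eLpNorm_map_measure hm (by fun_prop)]
      rfl
    refine le_of_eq ?_
    rw [Lp.norm_def g, ← ENNReal.toReal_mul, ← this]
    exact Lp.norm_toLp _ (h0 g)
  exact ⟨S.mkContinuous _ hS, fun g => (h0 g).coeFn_toLp⟩

end Affine

/-! ### Square integrable symbols -/

section SquareIntegrableSymbol

open scoped FourierTransform

theorem two_pi_ne_zero_complex : (2 * Real.pi : ℂ) ≠ 0 := by
  exact_mod_cast Real.two_pi_pos.ne'

theorem fourier_eq_integral_exp (f : ℝ → ℂ) (ξ : ℝ) :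
    𝓕 f ξ = ∫ s, Complex.exp (((-2 * Real.pi * s * ξ : ℝ) : ℂ) * Complex.I) * f s := by
  rw [Real.fourier_real_eq_integral_exp_smul]
  rfl

/-- The `L²` inverse Fourier transform as a bounded operator, shifted by `x / 2` to match the
centring of the plane waves. -/
theorem exists_shiftedFourierInv (x : ℝ) :
    ∃ A : Lp ℂ 2 (volume : Measure ℝ) →L[ℂ] Lp ℂ 2 (volume : Measure ℝ),
      ∀ g, A g =ᵐ[volume] fun t => 1 / (2 * Real.pi) *
        (𝓕 g : Lp ℂ 2 (volume : Measure ℝ)) ((2 * Real.pi)⁻¹ * t + -(x / 2 / (2 * Real.pi))) := by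
  obtain ⟨S, hS⟩ := exists_affineComposition (inv_ne_zero Real.two_pi_pos.ne')
    (-(x / 2 / (2 * Real.pi)))
  refine ⟨(1 / (2 * Real.pi) : ℂ) •
    (S ∘L (Lp.fourierTransformₗᵢ ℝ ℂ).toContinuousLinearEquiv.toContinuousLinearMap), fun g => ?_⟩
  refine (Lp.coeFn_smul (1 / (2 * Real.pi) : ℂ) (S (𝓕 g))).trans ?_
  filter_upwards [hS (𝓕 g)] with t ht
  rw [Pi.smul_apply, ht, smul_eq_mul]

variable {x : ℝ}

/-- Reflecting and dilating `1_{[0,x]} g` turns its Fourier integral into an integral of plane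
waves. -/
theorem fourier_indicator_comp_affine (g : ℝ → ℂ) (t ξ : ℝ) :
    𝓕 (fun s => (Set.Icc 0 x).indicator g (-(2 * Real.pi) * s + t)) ξ =
      1 / (2 * Real.pi) * (wave x (-ξ) t * ∫ u, wave x ξ u * g u ∂segment x) := by
  rw [fourier_eq_integral_exp]
  have e : ∀ s : ℝ, Complex.exp (((-2 * Real.pi * s * ξ : ℝ) : ℂ) * Complex.I) *
      (Set.Icc 0 x).indicator g (-(2 * Real.pi) * s + t) =
      (fun u => wave x (-ξ) t * (Set.Icc 0 x).indicator (fun u => wave x ξ u * g u) u)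
        (-(2 * Real.pi) * s + t) := by
    intro s
    simp only [Set.indicator_apply]
    split_ifs
    · rw [← mul_assoc, wave_neg_mul_wave]
      congr 2
      push_cast
      ring
    · simp
  rw [funext e]
  refine (integral_comp_affine (fun u => wave x (-ξ) t *
    (Set.Icc 0 x).indicator (fun u => wave x ξ u * g u) u) _ _).trans ?_
  rw [integral_const_mul, integral_indicator measurableSet_Icc, segment,
    inv_neg, abs_neg, abs_of_pos (inv_pos.2 Real.two_pi_pos), Complex.real_smul]
  push_cast
  ring

variable {σ : ℝ → ℂ}

/-- The convolution theorem for the square integrable kernel `𝓕⁻¹[σ - 1]` and a function supported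
on the segment. -/
theorem ae_fourierInv_comp_eq (hσ : MemLp (fun ξ => σ ξ - 1) 2 (volume : Measure ℝ))
    {A : Lp ℂ 2 (volume : Measure ℝ) →L[ℂ] Lp ℂ 2 (volume : Measure ℝ)}
    (hA : ∀ g, A g =ᵐ[volume] fun t => 1 / (2 * Real.pi) *
      (𝓕 g : Lp ℂ 2 (volume : Measure ℝ)) ((2 * Real.pi)⁻¹ * t + -(x / 2 / (2 * Real.pi))))
    {B : Lp ℂ 2 (segment x) →L[ℂ] Lp ℂ 2 (volume : Measure ℝ)}
    (hB : ∀ g, B g =ᵐ[volume] fun ξ => (σ ξ - 1) * ∫ s, wave x ξ s * g s ∂segment x)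
    (g : Lp ℂ 2 (segment x)) :
    ∀ᵐ t, Integrable (fun s => fourierInvL2 hσ.toLp (t - s) * g s) (segment x) ∧
      A (B g) t = ∫ s, fourierInvL2 hσ.toLp (t - s) * g s ∂segment x := by
  have h2π : -(2 * Real.pi) ≠ 0 := neg_ne_zero.2 Real.two_pi_pos.ne'
  have hg2 : MemLp ((Set.Icc 0 x).indicator g) 2 volume :=
    (memLp_indicator_iff_restrict measurableSet_Icc).2 (Lp.memLp g)
  have hg1 : MemLp ((Set.Icc 0 x).indicator g) 1 volume :=
    (memLp_indicator_iff_restrict measurableSet_Icc).2 ((Lp.memLp g).mono_exponent one_le_two)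
  have hG := fun t => integral_fourier_mul_eq
    (memLp_one_iff_integrable.1 (memLp_comp_affine hg1 h2π t)) (memLp_comp_affine hg2 h2π t)
    hσ.toLp
  simp only [fourier_indicator_comp_affine] at hG
  -- at `t = x / 2` the wave in `hG` is `1`: the transform of `g` is square integrable, and `B g` is
  -- a product of two functions of `L²`
  have hBg : Integrable (B g) := by
    have := (integrable_mul_of_memLp_two hσ (hG (x / 2)).1).const_mul (2 * Real.pi : ℂ)
    refine this.congr ?_
    filter_upwards [hB g] with ξ hξ
    have h1 : wave x (-ξ) (x / 2) = 1 := by simp [wave]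
    have := two_pi_ne_zero_complex
    rw [hξ, fourier_indicator_comp_affine, h1]
    field_simp
  have hF := fourier_toLp_ae_eq hBg (Lp.memLp (B g))
  rw [Lp.toLp_coeFn] at hF
  filter_upwards [hA (B g), (quasiMeasurePreserving_affine (inv_ne_zero Real.two_pi_pos.ne')
    (-(x / 2 / (2 * Real.pi)))).ae hF] with t h1 h2
  have hk : MemLp (fun s => fourierInvL2 hσ.toLp (t - s)) 2 volume := by
    have := (memLp_comp_affine (Lp.memLp (𝓕 hσ.toLp : Lp ℂ 2 (volume : Measure ℝ)))
      (neg_ne_zero.2 (inv_ne_zero Real.two_pi_pos.ne')) (t / (2 * Real.pi))).const_mul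
        (1 / (2 * Real.pi) : ℂ)
    refine (memLp_congr_ae (Filter.Eventually.of_forall fun s => ?_)).2 this
    have hs : (t - s) / (2 * Real.pi) = -(2 * Real.pi)⁻¹ * s + t / (2 * Real.pi) := by ring
    simp only [fourierInvL2, hs]
  refine ⟨integrable_mul_of_memLp_two (hk.restrict _) (Lp.memLp g), ?_⟩
  -- the substitution `u = t - 2πs`
  have e1 : ∫ s, (𝓕 hσ.toLp : Lp ℂ 2 (volume : Measure ℝ)) s *
      (Set.Icc 0 x).indicator g (-(2 * Real.pi) * s + t) =
        ∫ s, fourierInvL2 hσ.toLp (t - s) * g s ∂segment x := by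
    have e : ∀ s : ℝ, (𝓕 hσ.toLp : Lp ℂ 2 (volume : Measure ℝ)) s *
        (Set.Icc 0 x).indicator g (-(2 * Real.pi) * s + t) =
        (fun u => (Set.Icc 0 x).indicator (fun u => (𝓕 hσ.toLp : Lp ℂ 2 (volume : Measure ℝ))
          ((t - u) / (2 * Real.pi)) * g u) u) (-(2 * Real.pi) * s + t) := by
      intro s
      have hs : (t - (-(2 * Real.pi) * s + t)) / (2 * Real.pi) = s := by
        field_simp
        ring
      simp only [Set.indicator_apply, mul_ite, mul_zero, hs]
    simp only [e]
    rw [integral_comp_affine, integral_indicator measurableSet_Icc, inv_neg, abs_neg,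
      abs_of_pos (inv_pos.2 Real.two_pi_pos), Complex.real_smul, ← integral_const_mul]
    simp only [fourierInvL2, mul_assoc]
    push_cast
    simp
  rw [h1, h2, fourier_eq_integral_exp, ← e1, (hG t).2, ← integral_const_mul]
  refine integral_congr_ae ?_
  filter_upwards [hB g, hσ.coeFn_toLp] with ξ h3 h4
  have hw : Complex.exp (((-2 * Real.pi * ξ * ((2 * Real.pi)⁻¹ * t + -(x / 2 / (2 * Real.pi))) :
      ℝ) : ℂ) * Complex.I) = wave x (-ξ) t := by
    rw [wave]
    congr 3
    field_simp
    ring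
  rw [hw, h3, h4]
  ring

/-- Restricting to the segment between the two Fourier transforms gives the sine kernel. -/
theorem ae_comp_fourierInv_eq (hx : 0 < x)
    {A : Lp ℂ 2 (volume : Measure ℝ) →L[ℂ] Lp ℂ 2 (volume : Measure ℝ)}
    (hA : ∀ g, A g =ᵐ[volume] fun t => 1 / (2 * Real.pi) *
      (𝓕 g : Lp ℂ 2 (volume : Measure ℝ)) ((2 * Real.pi)⁻¹ * t + -(x / 2 / (2 * Real.pi))))
    {B : Lp ℂ 2 (segment x) →L[ℂ] Lp ℂ 2 (volume : Measure ℝ)}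
    (hB : ∀ g, B g =ᵐ[volume] fun ξ => (σ ξ - 1) * ∫ s, wave x ξ s * g s ∂segment x)
    {R : Lp ℂ 2 (volume : Measure ℝ) →L[ℂ] Lp ℂ 2 (segment x)}
    (hR : ∀ g, R g =ᵐ[segment x] g) (g : Lp ℂ 2 (volume : Measure ℝ)) :
    ∀ᵐ ξ, Integrable (fun η => kernelV2 x σ ξ η * g η) ∧
      B (R (A g)) ξ = ∫ η, kernelV2 x σ ξ η * g η := by
  have h2π : 2 * Real.pi ≠ 0 := Real.two_pi_pos.ne'
  filter_upwards [hB (R (A g))] with ξ hξ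
  have hc : Continuous fun t => wave x ξ t := by
    unfold wave
    fun_prop
  have hI : ∀ p, MemLp ((Set.Icc 0 x).indicator fun t => wave x ξ t) p volume := fun p =>
    (memLp_indicator_iff_restrict measurableSet_Icc).2 <|
      MemLp.of_bound hc.aestronglyMeasurable 1 <|
        Filter.Eventually.of_forall fun t => (norm_wave x ξ t).le
  obtain ⟨hG2, hG⟩ := integral_fourier_mul_eq
    (memLp_one_iff_integrable.1 (memLp_comp_affine (hI 1) h2π (x / 2)))
    (memLp_comp_affine (hI 2) h2π (x / 2)) g
  have hFG : ∀ η, 𝓕 (fun s => (Set.Icc 0 x).indicator (fun t => wave x ξ t)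
      (2 * Real.pi * s + x / 2)) η = sineKernel x ξ η := by
    intro η
    rw [fourier_eq_integral_exp]
    have e : ∀ s : ℝ, Complex.exp (((-2 * Real.pi * s * η : ℝ) : ℂ) * Complex.I) *
        (Set.Icc 0 x).indicator (fun t => wave x ξ t) (2 * Real.pi * s + x / 2) =
        (fun u => (Set.Icc 0 x).indicator (fun u => wave x (ξ - η) u) u)
          (2 * Real.pi * s + x / 2) := by
      intro s
      simp only [Set.indicator_apply]
      split_ifs
      · rw [← wave_mul_wave, mul_comm]
        congr 1
        rw [wave]
        congr 3
        ring
      · simp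
    simp only [e]
    rw [integral_comp_affine, integral_indicator measurableSet_Icc, ← integral_wave hx,
      abs_of_pos (inv_pos.2 Real.two_pi_pos), Complex.real_smul]
    push_cast
    rw [one_div]
  have hFG' : 𝓕 (fun s => (Set.Icc 0 x).indicator (fun t => wave x ξ t)
      (2 * Real.pi * s + x / 2)) = sineKernel x ξ := funext hFG
  rw [hFG'] at hG2 hG
  simp only [kernelV2, mul_assoc, integral_const_mul]
  refine ⟨(integrable_mul_of_memLp_two hG2 (Lp.memLp g)).const_mul _, ?_⟩
  rw [hξ]
  congr 1
  -- the multiplication formula, then the substitution `u = 2πs + x / 2`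
  have e2 : ∫ η, sineKernel x ξ η * g η = ∫ η, g η * sineKernel x ξ η := by
    simp only [mul_comm]
  rw [e2, ← hG]
  have e : ∀ s : ℝ, (𝓕 g : Lp ℂ 2 (volume : Measure ℝ)) s *
      (Set.Icc 0 x).indicator (fun t => wave x ξ t) (2 * Real.pi * s + x / 2) =
      (fun u => (Set.Icc 0 x).indicator (fun u => wave x ξ u * (𝓕 g : Lp ℂ 2 (volume : Measure ℝ))
        ((2 * Real.pi)⁻¹ * u + -(x / 2 / (2 * Real.pi)))) u) (2 * Real.pi * s + x / 2) := by
    intro s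
    have hs : (2 * Real.pi)⁻¹ * (2 * Real.pi * s + x / 2) + -(x / 2 / (2 * Real.pi)) = s := by
      field_simp
      ring
    simp only [Set.indicator_apply, ite_mul, zero_mul, hs,
      mul_comm ((𝓕 g : Lp ℂ 2 (volume : Measure ℝ)) s)]
  simp only [e]
  rw [integral_comp_affine, integral_indicator measurableSet_Icc,
    abs_of_pos (inv_pos.2 Real.two_pi_pos), Complex.real_smul, ← integral_const_mul]
  refine integral_congr_ae ?_
  filter_upwards [hR (A g), ae_restrict_of_ae (hA g)] with t h1 h2
  rw [h1, h2]
  push_cast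
  ring

theorem exists_operators_of_memLp_two_symbol
    (hσ : MemLp (fun ξ => σ ξ - 1) 2 (volume : Measure ℝ)) (hx : 0 < x) :
    ∃ (K : Lp ℂ 2 (segment x) →L[ℂ] Lp ℂ 2 (segment x))
      (K' V : Lp ℂ 2 (volume : Measure ℝ) →L[ℂ] Lp ℂ 2 (volume : Measure ℝ)),
      IsIntegralOperator (segment x) (fun t t' => fourierInvL2 hσ.toLp (t - t')) K ∧
      IsIntegralOperator volume (fun t t' => (Set.Icc 0 x).indicator
        (fun u => fourierInvL2 hσ.toLp (t - u)) t') K' ∧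
      IsIntegralOperator volume (kernelV2 x σ) V ∧
      IsHilbertSchmidt K ∧ IsHilbertSchmidt K' ∧ IsHilbertSchmidt V ∧
      IsTraceClass ((1 + K) * NormedSpace.exp (-K) - 1) ∧
      IsTraceClass ((1 + K') * NormedSpace.exp (-K') - 1) ∧
      IsTraceClass ((1 + V) * NormedSpace.exp (-V) - 1) ∧
      fredholmDet₂ (1 + K) = fredholmDet₂ (1 + V) ∧
      fredholmDet₂ (1 + K') = fredholmDet₂ (1 + V) := by
  obtain ⟨A, hA⟩ := exists_shiftedFourierInv x
  obtain ⟨B, hBS, hB⟩ := exists_kernelOperator (μ := volume) (ν := segment x) (continuous_wave x)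
    (fun ξ t => (norm_wave x ξ t).le) hσ (memLp_const 1)
  simp only [one_mul] at hB
  set R := LpToLpRestrictCLM ℝ ℂ ℂ volume 2 (Set.Icc 0 x)
  have hR : ∀ g, R g =ᵐ[segment x] g := LpToLpRestrictCLM_coeFn ℂ (Set.Icc 0 x)
  obtain ⟨hK1, hV1, hdet⟩ := fredholmDet₂_one_add_comp_comm (R ∘L A) hBS
  obtain ⟨hK2, -, hdet'⟩ := fredholmDet₂_one_add_comp_comm A (hBS.comp_right R)
  refine ⟨(R ∘L A) ∘L B, A ∘L (B ∘L R), B ∘L (R ∘L A), fun g => ?_, fun g => ?_, fun g => ?_,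
    (hBS.comp_left _).isHilbertSchmidt, ((hBS.comp_right R).comp_left A).isHilbertSchmidt,
    (hBS.comp_right _).isHilbertSchmidt, hK1, hK2, hV1, hdet, hdet'⟩
  · filter_upwards [hR (A (B g)), ae_restrict_of_ae (ae_fourierInv_comp_eq hσ hA hB g)] with t h1 h2
    exact ⟨h2.1, h1.trans h2.2⟩
  · filter_upwards [ae_fourierInv_comp_eq hσ hA hB (R g)] with t ht
    have e : ∀ u, (Set.Icc 0 x).indicator (fun u => fourierInvL2 hσ.toLp (t - u)) u * g u =
        (Set.Icc 0 x).indicator (fun u => fourierInvL2 hσ.toLp (t - u) * g u) u := fun u => by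
      simp only [Set.indicator_apply, ite_mul, zero_mul]
    have hae : (fun u => fourierInvL2 hσ.toLp (t - u) * R g u) =ᵐ[segment x]
        fun u => fourierInvL2 hσ.toLp (t - u) * g u := by
      filter_upwards [hR g] with u hu
      rw [hu]
    simp only [e]
    rw [integral_indicator measurableSet_Icc, integrable_indicator_iff measurableSet_Icc]
    exact ⟨ht.1.congr hae, ht.2.trans (integral_congr_ae hae)⟩
  · exact ae_comp_fourierInv_eq hx hA hB hR g

end SquareIntegrableSymbol

end WienerHopf

theorem mainTheorem4 (x : ℝ) (hx : 0 < x) :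
    -- symbols with `σ - 1 ∈ L²(ℝ)`
    (∀ (σ : ℝ → ℂ) (hσ : MemLp (fun ξ => σ ξ - 1) 2 (volume : Measure ℝ)),
      ∃ (K : Lp ℂ 2 (WienerHopf.segment x) →L[ℂ] Lp ℂ 2 (WienerHopf.segment x))
        (K' V : Lp ℂ 2 (volume : Measure ℝ) →L[ℂ] Lp ℂ 2 (volume : Measure ℝ)),
        -- `K` acts on `L²([0, x])`, while `K'` acts on `L²(ℝ)` by `g ↦ ∫₀ˣ K(t - t') g(t') dt'`
        WienerHopf.IsIntegralOperator (WienerHopf.segment x)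
          (fun t t' => WienerHopf.fourierInvL2 hσ.toLp (t - t')) K ∧
        WienerHopf.IsIntegralOperator volume
          (fun t t' => (Set.Icc 0 x).indicator
            (fun u => WienerHopf.fourierInvL2 hσ.toLp (t - u)) t') K' ∧
        WienerHopf.IsIntegralOperator volume (WienerHopf.kernelV2 x σ) V ∧
        WienerHopf.IsHilbertSchmidt K ∧
        WienerHopf.IsHilbertSchmidt K' ∧
        WienerHopf.IsHilbertSchmidt V ∧
        WienerHopf.IsTraceClass ((1 + K) * NormedSpace.exp (-K) - 1) ∧
        WienerHopf.IsTraceClass ((1 + K') * NormedSpace.exp (-K') - 1) ∧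
        WienerHopf.IsTraceClass ((1 + V) * NormedSpace.exp (-V) - 1) ∧
        WienerHopf.fredholmDet₂ (1 + K) = WienerHopf.fredholmDet₂ (1 + V) ∧
        WienerHopf.fredholmDet₂ (1 + K') = WienerHopf.fredholmDet₂ (1 + V)) ∧
    -- symbols with `σ - 1 ∈ L¹(ℝ)`; `r` is any measurable branch of the square root of `σ - 1`
    (∀ σ : ℝ → ℂ, MemLp (fun ξ => σ ξ - 1) 1 (volume : Measure ℝ) →
      ∀ r : ℝ → ℂ, AEStronglyMeasurable r (volume : Measure ℝ) →
      (∀ ξ, r ξ ^ 2 = σ ξ - 1) →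
      ∃ (K : Lp ℂ 2 (WienerHopf.segment x) →L[ℂ] Lp ℂ 2 (WienerHopf.segment x))
        (V : Lp ℂ 2 (volume : Measure ℝ) →L[ℂ] Lp ℂ 2 (volume : Measure ℝ)),
        WienerHopf.IsIntegralOperator (WienerHopf.segment x)
          (fun t t' => WienerHopf.fourierInvL1 (fun ξ => σ ξ - 1) (t - t')) K ∧
        WienerHopf.IsIntegralOperator volume (WienerHopf.kernelV1 x r) V ∧
        WienerHopf.IsTraceClass K ∧
        WienerHopf.IsTraceClass V ∧
        WienerHopf.fredholmDet (1 + K) = WienerHopf.fredholmDet (1 + V)) :=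
  ⟨fun _ hσ => WienerHopf.exists_operators_of_memLp_two_symbol hσ hx,
    fun _ hσ _ hr hrσ => WienerHopf.exists_operators_of_integrable_symbol hx hσ hr hrσ⟩
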